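/- For an integer $n\ge 2$ let $\theta_k=\frac{2\pi k}{2n+1}$, $k=0,\dots,2n$, and let $\overline f_0,\dots,\overline f_{2n}$ be real numbers (the estimates of the values $f(\theta_k)$ of a function $f$). Let $$\widetilde{\mathcal R}(\theta)=\sum_{s=1}^n\left[a_s\cos(s\theta)+b_s\sin(s\theta)\right]+c$$ be the trigonometric polynomial of degree at most $n$ whose $2n+1$ real coefficients are obtained by solving the (nonsingular) linear system $\widetilde{\mathcal R}(\theta_k)=\overline f_k$, $k=0,\dots,2n$. **Theorem.** For all real $p>0$ and $C$ there is a constant $K$, depending only on $p$ and $C$, such that the following holds. Let $n\ge2$, let $f:\mathbb R\to\mathbb R$ be $2\pi$-periodic with $|f(\theta)|\le1$ for all $\theta$ and Lipschitz with constant $M\ge 0$, let $\overline f_0,\dots,\overline f_{2n}$ be any real estimates, and let $\varepsilon'=\max_{0\le k\le 2n}|f(\theta_k)-\overline f_k|$ be the maximum estimation error. If $\theta\in\mathbb R$ satisfies $|\theta-\theta_k|\le C/n^{p}$ for some $k$, then $$|f(\theta)-\widetilde{\mathcal R}(\theta)|\le K\max\left\{\frac{M\log n}{n^{\max\{1,p\}}},\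 \varepsilon'\log n\right\}.$$ In particular, $|f(\theta)-\widetilde{\mathcal R}(\theta)|=O\left(\max\{M/\mathrm{poly}(n),\varepsilon'\log n\}\right)$ for $\theta$ within $O(1/\mathrm{poly}(n))$ of a node. -/

import Mathlib

open scoped NNReal

noncomputable section

/-- The `2n+1` equispaced nodes `2πk/(2n+1)`, `k = 0, …, 2n`, in `[0, 2π)`. -/
def sampleNode (n : ℕ) (k : Fin (2 * n + 1)) : ℝ :=
  2 * Real.pi * (k : ℝ) / (2 * (n : ℝ) + 1)

/-- The `2n+1` basis functions of trigonometric polynomials of degree `n`, in the order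
`cos θ, …, cos (nθ), sin θ, …, sin (nθ), 1`. -/
def trigBasis (n : ℕ) (j : Fin (2 * n + 1)) (θ : ℝ) : ℝ :=
  if (j : ℕ) < n then Real.cos ((((j : ℕ) + 1 : ℕ) : ℝ) * θ)
  else if (j : ℕ) < 2 * n then Real.sin ((((j : ℕ) - n + 1 : ℕ) : ℝ) * θ)
  else 1

/-- The square matrix `A` of the linear system for the coefficients: row `k` holds the values of
the basis functions at the `k`-th node. -/
def samplingMatrix (n : ℕ) : Matrix (Fin (2 * n + 1)) (Fin (2 * n + 1)) ℝ :=
  Matrix.of fun k j => trigBasis n j (sampleNode n k)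

/-- The coefficient vector `x = A⁻¹ d` obtained from the data `d` at the nodes. -/
def inferredCoeffs (n : ℕ) (d : Fin (2 * n + 1) → ℝ) : Fin (2 * n + 1) → ℝ :=
  Matrix.mulVec (samplingMatrix n)⁻¹ d

/-- The inferred response: the trigonometric polynomial of degree `n` whose coefficients solve the
linear system with right-hand side the estimates `d` at the nodes. -/
def inferredResponse (n : ℕ) (d : Fin (2 * n + 1) → ℝ) (θ : ℝ) : ℝ :=
  ∑ j, inferredCoeffs n d j * trigBasis n j θ

/-- The maximum estimation error `max_k |f(θ_k) - d_k|` over the nodes. -/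
def maxEstimationError (n : ℕ) (f : ℝ → ℝ) (d : Fin (2 * n + 1) → ℝ) : ℝ :=
  Finset.univ.sup' Finset.univ_nonempty fun k => |f (sampleNode n k) - d k|

end

/-!
Write `N = 2n+1` and let `D` be the Dirichlet kernel. Discrete orthogonality of the trigonometric
basis inverts the sampling matrix explicitly, and the interpolant of data `d` becomes
`N⁻¹ ∑ k, d k * D (θ - θ_k)` (`inferredResponse_eq`). It is linear in `d` and reproduces constants.

Let `x₀` be the node nearest to `θ` among all integer multiples of `2π/N`, and `δ = θ - x₀`, so that
`|δ| ≤ π/N`. Two errors have to be bounded.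

* The estimates `d` differ from the exact data by at most `ε'`, which costs at most `ε'` times the
  Lebesgue function, of size `O(log n)` (`abs_inferredResponse_le`).
* For exact data, subtract the constant `f x₀`. At the `i`-th node on either side of `x₀` the kernel
  is `± sin (N δ / 2) / sin ((x_i - δ) / 2)` with alternating signs. The quotients
  `(f (x₀ + x_i) - f x₀) / sin ((x_i - δ) / 2)` are `O(M)` with increments `O(M / i)`, so summation
  by parts bounds their alternating sum by `O(M log n)`, and `|sin (N δ / 2)| ≤ N |δ| / 2` yields
  `O(M |δ| log n)` in total (`abs_oneSided_sum_le`, `abs_inferredResponse_sub_node_le`).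

Both `|δ| ≤ π/N` and `|δ| ≤ C / n^p` hold, hence `|δ| = O(n ^ (-max 1 p))`. This covers `p ≤ 1` and
`p > 1` at once and needs no best-approximation theorem.
-/

/-! ### The Dirichlet kernel and the extended nodes -/

/-- The Dirichlet kernel `1 + 2 ∑_{s=1}^n cos (s t) = ∑_{|s| ≤ n} e^{ist}`, written as a cosine sum
so that no division by `sin (t / 2)` occurs. -/
noncomputable def dirichletSum (n : ℕ) (t : ℝ) : ℝ :=
  1 + 2 * ∑ s ∈ Finset.range n, Real.cos (((s + 1 : ℕ) : ℝ) * t)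

/-- The nodes `2πk/(2n+1)` for all integers `k`: the nearest one to a real point always exists, and
sums over the `2n+1` nodes of one period may be recentred at it. -/
noncomputable def intNode (n : ℕ) (k : ℤ) : ℝ := 2 * Real.pi * (k : ℝ) / (2 * (n : ℝ) + 1)

theorem sampleNode_eq_intNode (n : ℕ) (k : Fin (2 * n + 1)) :
    sampleNode n k = intNode n ((k : ℕ) : ℤ) := by
  simp [sampleNode, intNode]

theorem intNode_add (n : ℕ) (a b : ℤ) : intNode n (a + b) = intNode n a + intNode n b := by
  simp only [intNode]; push_cast; ring

theorem intNode_neg (n : ℕ) (a : ℤ) : intNode n (-a) = -intNode n a := by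
  simp only [intNode]; push_cast; ring

theorem intNode_zero (n : ℕ) : intNode n 0 = 0 := by simp [intNode]

theorem intNode_period (n : ℕ) : intNode n ((2 * n + 1 : ℕ) : ℤ) = 2 * Real.pi := by
  simp only [intNode]; push_cast; field_simp

theorem half_mul_intNode (n : ℕ) (k : ℤ) :
    (2 * (n : ℝ) + 1) * intNode n k / 2 = k * Real.pi := by
  simp only [intNode]; field_simp

theorem dirichletSum_neg (n : ℕ) (t : ℝ) : dirichletSum n (-t) = dirichletSum n t := by
  simp [dirichletSum]

theorem dirichletSum_periodic (n : ℕ) : Function.Periodic (dirichletSum n) (2 * Real.pi) := by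
  intro t
  simp only [dirichletSum]
  congr 2
  refine Finset.sum_congr rfl fun s _ => ?_
  rw [mul_add, Real.cos_add_nat_mul_two_pi]

theorem dirichletSum_mul_sin (n : ℕ) (t : ℝ) :
    dirichletSum n t * Real.sin (t / 2) = Real.sin ((2 * (n : ℝ) + 1) * t / 2) := by
  induction n with
  | zero => simp [dirichletSum]
  | succ m ih =>
    have h : dirichletSum (m + 1) t
        = dirichletSum m t + 2 * Real.cos (((m + 1 : ℕ) : ℝ) * t) := by
      simp only [dirichletSum, Finset.sum_range_succ]; ring
    rw [h, add_mul, ih]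
    have e1 : (2 * (m : ℝ) + 1) * t / 2 = ((m + 1 : ℕ) : ℝ) * t - t / 2 := by push_cast; ring
    have e2 : (2 * ((m + 1 : ℕ) : ℝ) + 1) * t / 2 = ((m + 1 : ℕ) : ℝ) * t + t / 2 := by ring
    rw [e1, e2, Real.sin_sub, Real.sin_add]; ring

theorem abs_dirichletSum_le (n : ℕ) (t : ℝ) : |dirichletSum n t| ≤ 2 * (n : ℝ) + 1 := by
  have h : |∑ s ∈ Finset.range n, Real.cos (((s + 1 : ℕ) : ℝ) * t)| ≤ n := by
    refine (Finset.abs_sum_le_sum_abs _ _).trans ?_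
    refine (Finset.sum_le_sum fun s _ => Real.abs_cos_le_one _).trans ?_
    simp
  have := abs_le.1 h
  rw [dirichletSum, abs_le]
  constructor <;> linarith

theorem dirichletSum_intNode_sub (n : ℕ) (a b : ℤ) (t : ℝ) :
    dirichletSum n (t - intNode n (a + ((2 * n + 1 : ℕ) : ℤ) * b))
      = dirichletSum n (t - intNode n a) := by
  have h : intNode n (a + ((2 * n + 1 : ℕ) : ℤ) * b) = intNode n a + b * (2 * Real.pi) := by
    simp only [intNode]; push_cast; field_simp
  rw [h, ← sub_sub, (dirichletSum_periodic n).sub_int_mul_eq]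

/-- The kernel vanishes at the difference of two distinct nodes, which makes it the kernel of
interpolation at the nodes. -/
theorem dirichletSum_sampleNode_sub {n : ℕ} {j k : Fin (2 * n + 1)} (h : j ≠ k) :
    dirichletSum n (sampleNode n j - sampleNode n k) = 0 := by
  have hsub : sampleNode n j - sampleNode n k = intNode n ((j : ℤ) - k) := by
    rw [sampleNode_eq_intNode, sampleNode_eq_intNode, sub_eq_add_neg (j : ℤ), intNode_add,
      intNode_neg, sub_eq_add_neg]
  have hne : ((j : ℤ) - k) ≠ 0 := by
    intro h0; exact h (Fin.ext (by omega))
  have hs : Real.sin (intNode n ((j : ℤ) - k) / 2) ≠ 0 := by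
    rw [Ne, Real.sin_eq_zero_iff]
    rintro ⟨m, hm⟩
    have hN : (2 * (n : ℝ) + 1) ≠ 0 := by positivity
    have h1 : (m : ℝ) * (2 * (n : ℝ) + 1) = (((j : ℤ) - k : ℤ) : ℝ) := by
      rw [intNode] at hm
      field_simp at hm
      linarith
    have h2 : m * (2 * (n : ℤ) + 1) = (j : ℤ) - k := by exact_mod_cast h1
    have hd : (2 * (n : ℤ) + 1) ∣ (j : ℤ) - k := ⟨m, by rw [← h2, mul_comm]⟩
    refine hne (Int.eq_zero_of_abs_lt_dvd hd ?_)
    have := j.2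
    have := k.2
    rw [abs_lt]; omega
  have := dirichletSum_mul_sin n (intNode n ((j : ℤ) - k))
  rw [half_mul_intNode, Real.sin_int_mul_pi] at this
  rw [hsub]
  exact (mul_eq_zero.1 this).resolve_right hs

/-! ### The interpolant in terms of the kernel -/

theorem sum_trigBasis_mul (n : ℕ) (t u : ℝ) :
    ∑ j : Fin (2 * n + 1), (if (j : ℕ) < 2 * n then 2 else 1) * trigBasis n j u * trigBasis n j t
      = dirichletSum n (t - u) := by
  have h := Fin.sum_univ_eq_sum_range (fun j : ℕ =>
      (if j < 2 * n then (2 : ℝ) else 1)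
        * (if j < n then Real.cos (((j + 1 : ℕ) : ℝ) * u)
            else if j < 2 * n then Real.sin (((j - n + 1 : ℕ) : ℝ) * u) else 1)
        * (if j < n then Real.cos (((j + 1 : ℕ) : ℝ) * t)
            else if j < 2 * n then Real.sin (((j - n + 1 : ℕ) : ℝ) * t) else 1)) (2 * n + 1)
  simp only [trigBasis]
  refine h.trans ?_
  rw [Finset.sum_range_succ, two_mul n, Finset.sum_range_add, dirichletSum, Finset.mul_sum,
    ← Finset.sum_add_distrib, add_comm (1 : ℝ)]
  congr 1
  · refine Finset.sum_congr rfl fun s hs => ?_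
    have hs := Finset.mem_range.1 hs
    have h1 : s < n + n := by omega
    have h2 : ¬ n + s < n := by omega
    have h3 : n + s < n + n := by omega
    have h4 : n + s - n = s := by omega
    simp only [hs, h1, h2, h3, h4, if_true, if_false]
    rw [mul_sub, Real.cos_sub]; ring
  · simp

/-- Discrete orthogonality: the inverse of the sampling matrix is its transpose with rows rescaled. -/
theorem samplingMatrix_mul_inverse (n : ℕ) :
    samplingMatrix n * (Matrix.of fun j k : Fin (2 * n + 1) =>
      (if (j : ℕ) < 2 * n then 2 else 1) * trigBasis n j (sampleNode n k) / (2 * (n : ℝ) + 1))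
      = 1 := by
  ext m k
  have hN : (2 * (n : ℝ) + 1) ≠ 0 := by positivity
  have h := sum_trigBasis_mul n (sampleNode n m) (sampleNode n k)
  have hsum : (samplingMatrix n * (Matrix.of fun j k : Fin (2 * n + 1) =>
      (if (j : ℕ) < 2 * n then 2 else 1) * trigBasis n j (sampleNode n k) / (2 * (n : ℝ) + 1))) m k
      = dirichletSum n (sampleNode n m - sampleNode n k) / (2 * (n : ℝ) + 1) := by
    rw [Matrix.mul_apply, ← h, Finset.sum_div]
    refine Finset.sum_congr rfl fun j _ => ?_
    simp only [samplingMatrix, Matrix.of_apply]; ring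
  rw [hsum]
  by_cases hmk : m = k
  · subst hmk
    rw [sub_self, Matrix.one_apply_eq]
    have : dirichletSum n 0 = 2 * (n : ℝ) + 1 := by simp [dirichletSum]; ring
    rw [this, div_self hN]
  · rw [dirichletSum_sampleNode_sub hmk, Matrix.one_apply_ne hmk, zero_div]

theorem inferredResponse_eq (n : ℕ) (d : Fin (2 * n + 1) → ℝ) (t : ℝ) :
    inferredResponse n d t
      = (∑ k, d k * dirichletSum n (t - sampleNode n k)) / (2 * (n : ℝ) + 1) := by
  simp only [inferredResponse, inferredCoeffs,
    Matrix.inv_eq_right_inv (samplingMatrix_mul_inverse n), Matrix.mulVec, dotProduct,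
    Matrix.of_apply, ← sum_trigBasis_mul, Finset.sum_mul, Finset.mul_sum, Finset.sum_div]
  rw [Finset.sum_comm]
  refine Finset.sum_congr rfl fun k _ => Finset.sum_congr rfl fun j _ => ?_
  ring

theorem inferredResponse_sub (n : ℕ) (d e : Fin (2 * n + 1) → ℝ) (t : ℝ) :
    inferredResponse n (d - e) t = inferredResponse n d t - inferredResponse n e t := by
  simp only [inferredResponse_eq, Pi.sub_apply, sub_mul, Finset.sum_sub_distrib, sub_div]

/-- A constant solves its own linear system, so it is reproduced exactly. -/
theorem inferredResponse_const (n : ℕ) (c t : ℝ) :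
    inferredResponse n (fun _ => c) t = c := by
  have hdet : IsUnit (samplingMatrix n).det :=
    (Matrix.isUnit_iff_isUnit_det _).1
      ⟨⟨_, _, samplingMatrix_mul_inverse n, mul_eq_one_comm.1 (samplingMatrix_mul_inverse n)⟩, rfl⟩
  have hlast : ∀ u, trigBasis n (Fin.last (2 * n)) u = 1 := by
    intro u
    have : ¬ 2 * n < n := by omega
    simp [trigBasis, this]
  have hd : (fun _ => c) = (samplingMatrix n).mulVec (Pi.single (Fin.last (2 * n)) c) := by
    ext k
    simp [samplingMatrix, hlast]
  have hc : inferredCoeffs n (fun _ => c) = Pi.single (Fin.last (2 * n)) c := by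
    rw [inferredCoeffs, hd, Matrix.mulVec_mulVec, Matrix.nonsing_inv_mul _ hdet, Matrix.one_mulVec]
  rw [inferredResponse, hc, Finset.sum_eq_single (Fin.last (2 * n))]
  · simp [hlast]
  · intro j _ hj; simp [hj]
  · simp

/-! ### Sums over one period -/

theorem sum_range_periodic_shift {N : ℕ} {h : ℤ → ℝ} (hh : Function.Periodic h (N : ℤ)) (a : ℤ) :
    ∑ i ∈ Finset.range N, h (a + i) = ∑ i ∈ Finset.range N, h i := by
  have step : ∀ a : ℤ, ∑ i ∈ Finset.range N, h (a + 1 + i) = ∑ i ∈ Finset.range N, h (a + i) := by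
    intro a
    have h1 := Finset.sum_range_succ (fun i : ℕ => h (a + i)) N
    have h2 := Finset.sum_range_succ' (fun i : ℕ => h (a + i)) N
    have h3 : ∀ i : ℕ, h (a + ((i + 1 : ℕ) : ℤ)) = h (a + 1 + i) := by
      intro i; congr 1; push_cast; ring
    simp only [h3] at h2
    rw [hh a] at h1
    simp only [Nat.cast_zero, add_zero] at h2
    linarith
  induction a using Int.induction_on with
  | zero => simp
  | succ i ih => rw [step, ih]
  | pred i ih => rw [← step, sub_add_cancel, ih]

/-- A sum over one period, recentred at `a` and split into the centre, the right and the left. -/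
theorem sum_fin_periodic (n : ℕ) {h : ℤ → ℝ} (hh : Function.Periodic h ((2 * n + 1 : ℕ) : ℤ))
    (a : ℤ) :
    ∑ k : Fin (2 * n + 1), h ((k : ℕ) : ℤ)
      = h a + ∑ i ∈ Finset.range n, h (a + ((i + 1 : ℕ) : ℤ))
        + ∑ i ∈ Finset.range n, h (a - ((i + 1 : ℕ) : ℤ)) := by
  rw [Fin.sum_univ_eq_sum_range (fun k : ℕ => h k), ← sum_range_periodic_shift hh (a - n),
    show 2 * n + 1 = n + (n + 1) by ring, Finset.sum_range_add, Finset.sum_range_succ',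
    ← Finset.sum_range_reflect (fun i : ℕ => h (a - n + i))]
  have e1 : ∀ i ∈ Finset.range n, h (a - n + ((n - 1 - i : ℕ) : ℤ)) = h (a - ((i + 1 : ℕ) : ℤ)) := by
    intro i hi
    have := Finset.mem_range.1 hi
    congr 1; omega
  have e2 : ∀ i ∈ Finset.range n, h (a - n + ((n + (i + 1) : ℕ) : ℤ)) = h (a + ((i + 1 : ℕ) : ℤ)) := by
    intro i _
    congr 1; omega
  rw [Finset.sum_congr rfl e1, Finset.sum_congr rfl e2]
  simp only [add_zero, sub_add_cancel]
  ring

/-! ### Size of the kernel at the shifted nodes -/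

/-- Jordan's inequality `sin y ≥ 2y/π`, using that `δ` is at most half of the node spacing. -/
theorem div_le_sin_half_intNode_sub {n i : ℕ} {δ : ℝ} (hi : 1 ≤ i) (hin : i ≤ n)
    (hδ : |δ| ≤ Real.pi / (2 * (n : ℝ) + 1)) :
    (i : ℝ) / (2 * (n : ℝ) + 1) ≤ Real.sin ((intNode n i - δ) / 2) := by
  have hN : 0 < 2 * (n : ℝ) + 1 := by positivity
  have hpi := Real.pi_pos
  obtain ⟨h1, h2⟩ := abs_le.1 hδ
  have hi' : (1 : ℝ) ≤ i := by exact_mod_cast hi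
  have hin' : (i : ℝ) ≤ n := by exact_mod_cast hin
  have hlow : Real.pi * i / (2 * (n : ℝ) + 1) ≤ intNode n i - δ := by
    have : Real.pi / (2 * (n : ℝ) + 1) ≤ Real.pi * i / (2 * (n : ℝ) + 1) := by
      gcongr; nlinarith
    have e : intNode n i = 2 * (Real.pi * i / (2 * (n : ℝ) + 1)) := by
      simp only [intNode]; push_cast; ring
    linarith
  have hup : intNode n i - δ ≤ Real.pi := by
    have : intNode n i + Real.pi / (2 * (n : ℝ) + 1) ≤ Real.pi := by
      have e : intNode n i + Real.pi / (2 * (n : ℝ) + 1)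
          = Real.pi * ((2 * i + 1) / (2 * (n : ℝ) + 1)) := by
        simp only [intNode]; push_cast; ring
      rw [e]
      refine mul_le_of_le_one_right hpi.le ?_
      rw [div_le_one hN]; linarith
    linarith
  have h0 : 0 ≤ intNode n i - δ := le_trans (by positivity) hlow
  have := Real.mul_le_sin (x := (intNode n i - δ) / 2) (by linarith) (by linarith)
  refine le_trans ?_ this
  have e : 2 / Real.pi * ((intNode n i - δ) / 2) = (intNode n i - δ) / Real.pi := by
    field_simp
  rw [e, le_div_iff₀ hpi]
  calc _ = Real.pi * i / (2 * (n : ℝ) + 1) := by ring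
    _ ≤ _ := hlow

/-- Along the nodes the numerator of the kernel only changes sign. -/
theorem dirichletSum_sub_intNode_mul (n : ℕ) (i : ℕ) (δ : ℝ) :
    dirichletSum n (δ - intNode n i) * Real.sin ((intNode n i - δ) / 2)
      = -((-1) ^ i * Real.sin ((2 * (n : ℝ) + 1) * δ / 2)) := by
  have h := dirichletSum_mul_sin n (δ - intNode n i)
  have e : (2 * (n : ℝ) + 1) * (δ - intNode n i) / 2
      = (2 * (n : ℝ) + 1) * δ / 2 - i * Real.pi := by
    have := half_mul_intNode n i
    push_cast at this
    linarith
  rw [e, Real.sin_sub_nat_mul_pi] at h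
  rw [← h, show (intNode n i - δ) / 2 = -((δ - intNode n i) / 2) by ring, Real.sin_neg]
  ring

theorem abs_dirichletSum_sub_intNode_le {n i : ℕ} {δ : ℝ} (hi : 1 ≤ i) (hin : i ≤ n)
    (hδ : |δ| ≤ Real.pi / (2 * (n : ℝ) + 1)) :
    |dirichletSum n (δ - intNode n i)| ≤ (2 * (n : ℝ) + 1) / i := by
  have hs := div_le_sin_half_intNode_sub hi hin hδ
  have hi' : (0 : ℝ) < i := by exact_mod_cast hi
  have h := congrArg abs (dirichletSum_sub_intNode_mul n i δ)
  rw [abs_mul, abs_neg, abs_mul, abs_pow, abs_neg, abs_one, one_pow, one_mul] at h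
  have h1 := Real.abs_sin_le_one ((2 * (n : ℝ) + 1) * δ / 2)
  have h2 : |dirichletSum n (δ - intNode n i)| * (i / (2 * (n : ℝ) + 1)) ≤ 1 := by
    rw [← h] at h1
    refine le_trans ?_ h1
    gcongr
    exact hs.trans (le_abs_self _)
  have h3 : (0 : ℝ) < i / (2 * (n : ℝ) + 1) := by positivity
  rw [← le_div_iff₀ h3] at h2
  simpa using h2

/-- Summation by parts for an alternating sum. With half of the next term added, each step changes
the sum by half a difference of consecutive terms. -/
theorem abs_alternating_sum_le (u : ℕ → ℝ) (m : ℕ) :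
    |∑ i ∈ Finset.range m, (-1) ^ i * u i + (-1) ^ m * (u m / 2)|
      ≤ |u 0| / 2 + (∑ i ∈ Finset.range m, |u (i + 1) - u i|) / 2 := by
  induction m with
  | zero => simp [abs_div]
  | succ m ih =>
    have e : ∑ i ∈ Finset.range (m + 1), (-1) ^ i * u i + (-1) ^ (m + 1) * (u (m + 1) / 2)
        = (∑ i ∈ Finset.range m, (-1) ^ i * u i + (-1) ^ m * (u m / 2))
          + (-1) ^ m * ((u m - u (m + 1)) / 2) := by
      rw [Finset.sum_range_succ]; ring
    have e2 : |(-1 : ℝ) ^ m * ((u m - u (m + 1)) / 2)| = |u (m + 1) - u m| / 2 := by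
      rw [abs_mul, abs_pow, abs_neg, abs_one, one_pow, one_mul, abs_div, abs_sub_comm]
      simp
    rw [e, Finset.sum_range_succ]
    refine (abs_add_le _ _).trans ?_
    rw [e2]
    linarith

theorem sum_one_div_succ_le (n : ℕ) :
    ∑ i ∈ Finset.range n, (1 : ℝ) / ((i + 1 : ℕ) : ℝ) ≤ 1 + Real.log n := by
  have h := harmonic_le_one_add_log n
  simpa [harmonic] using h

/-- The logarithmic bound on the Lebesgue function of the interpolation, before division by
`2n+1`. -/
theorem sum_abs_dirichletSum_le (n : ℕ) {k₀ : ℤ} {t : ℝ}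
    (ht : |t - intNode n k₀| ≤ Real.pi / (2 * (n : ℝ) + 1)) :
    ∑ k, |dirichletSum n (t - sampleNode n k)| ≤ (2 * (n : ℝ) + 1) * (3 + 2 * Real.log n) := by
  have hN : 0 < 2 * (n : ℝ) + 1 := by positivity
  have hper : Function.Periodic (fun k : ℤ => |dirichletSum n (t - intNode n k)|)
      ((2 * n + 1 : ℕ) : ℤ) := by
    intro k
    have := dirichletSum_intNode_sub n k 1 t
    rw [mul_one] at this
    simp only [this]
  simp only [sampleNode_eq_intNode]
  rw [sum_fin_periodic n hper k₀]
  have hsum : ∑ i ∈ Finset.range n, (2 * (n : ℝ) + 1) / ((i + 1 : ℕ) : ℝ)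
      ≤ (2 * (n : ℝ) + 1) * (1 + Real.log n) := by
    refine le_trans (le_of_eq ?_) (mul_le_mul_of_nonneg_left (sum_one_div_succ_le n) hN.le)
    rw [Finset.mul_sum]
    exact Finset.sum_congr rfl fun i _ => by ring
  have h0 := abs_dirichletSum_le n (t - intNode n k₀)
  have h1 : ∑ i ∈ Finset.range n, |dirichletSum n (t - intNode n (k₀ + ((i + 1 : ℕ) : ℤ)))|
      ≤ ∑ i ∈ Finset.range n, (2 * (n : ℝ) + 1) / ((i + 1 : ℕ) : ℝ) := by
    refine Finset.sum_le_sum fun i hi => ?_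
    rw [intNode_add, ← sub_sub]
    exact abs_dirichletSum_sub_intNode_le (by omega) (Finset.mem_range.1 hi) ht
  have h2 : ∑ i ∈ Finset.range n, |dirichletSum n (t - intNode n (k₀ - ((i + 1 : ℕ) : ℤ)))|
      ≤ ∑ i ∈ Finset.range n, (2 * (n : ℝ) + 1) / ((i + 1 : ℕ) : ℝ) := by
    refine Finset.sum_le_sum fun i hi => ?_
    rw [sub_eq_add_neg k₀, intNode_add, intNode_neg, ← dirichletSum_neg,
      show -(t - (intNode n k₀ + -intNode n ((i + 1 : ℕ) : ℤ)))
        = -(t - intNode n k₀) - intNode n ((i + 1 : ℕ) : ℤ) by ring]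
    exact abs_dirichletSum_sub_intNode_le (by omega) (Finset.mem_range.1 hi) (by rwa [abs_neg])
  linarith

/-! ### Interpolation of a Lipschitz function near a node -/

theorem abs_sub_le_of_lipschitz {g : ℝ → ℝ} {M : ℝ≥0} (hg : LipschitzWith M g) (x y : ℝ) :
    |g x - g y| ≤ M * |x - y| := by
  simpa [Real.dist_eq] using hg.dist_le_mul x y

/-- The contribution of the nodes on one side of `0`. The factor `|δ|`, rather than `1/(2n+1)`, comes
from `|sin ((2n+1)δ/2)|`; the sum stays logarithmic because the remaining weights
`(g x_i - g 0) / sin ((x_i - δ)/2)` alternate in sign and have increments `O(M/i)`. -/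
theorem abs_oneSided_sum_le {n : ℕ} {δ : ℝ} (hδ : |δ| ≤ Real.pi / (2 * (n : ℝ) + 1))
    {g : ℝ → ℝ} {M : ℝ≥0} (hg : LipschitzWith M g) :
    |∑ i ∈ Finset.range n, (g (intNode n ((i + 1 : ℕ) : ℤ)) - g 0)
        * dirichletSum n (δ - intNode n ((i + 1 : ℕ) : ℤ))|
      ≤ (2 * (n : ℝ) + 1) * |δ| / 2
        * (M * (Real.pi * (1 + Real.pi) * (1 + Real.log n) + Real.pi)) := by
  have hN : 0 < 2 * (n : ℝ) + 1 := by positivity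
  have hpi := Real.pi_pos
  set N : ℝ := 2 * (n : ℝ) + 1 with hNdef
  set s : ℕ → ℝ := fun i => Real.sin ((intNode n i - δ) / 2) with hs
  set v : ℕ → ℝ := fun i => g (intNode n i) - g 0 with hv
  set u : ℕ → ℝ := fun i => v i / s i with hu
  have hx : ∀ i : ℕ, intNode n i = 2 * Real.pi * i / N := by
    intro i; simp [intNode, hNdef]
  have hsl : ∀ i, 1 ≤ i → i ≤ n → (i : ℝ) / N ≤ s i := fun i h1 h2 =>
    div_le_sin_half_intNode_sub h1 h2 hδ
  have hspos : ∀ i, 1 ≤ i → i ≤ n → 0 < s i := fun i h1 h2 => by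
    refine lt_of_lt_of_le ?_ (hsl i h1 h2)
    have : (0 : ℝ) < i := by exact_mod_cast h1
    positivity
  have hv0 : v 0 = 0 := by simp [hv, intNode_zero]
  -- The term `i = 0` vanishes even when `δ = 0`, where `s 0 = 0`: its numerator is `0`.
  have hu0 : u 0 = 0 := by simp [hu, hv0]
  have hvb : ∀ i, |v i| ≤ M * (2 * Real.pi * i / N) := by
    intro i
    have := abs_sub_le_of_lipschitz hg (intNode n i) 0
    rw [sub_zero, abs_of_nonneg (a := intNode n i) (by rw [hx]; positivity)] at this
    rwa [← hx]
  have hub : ∀ i, i ≤ n → |u i| ≤ 2 * Real.pi * M := by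
    intro i hi
    rcases Nat.eq_zero_or_pos i with rfl | h1
    · rw [hu0, abs_zero]; positivity
    · rw [hu, abs_div, abs_of_pos (hspos i h1 hi), div_le_iff₀ (hspos i h1 hi)]
      refine (hvb i).trans ?_
      have := mul_le_mul_of_nonneg_left (hsl i h1 hi) (by positivity : 0 ≤ 2 * Real.pi * (M : ℝ))
      refine le_trans (le_of_eq ?_) this
      ring
  have hdiff : ∀ i, i < n →
      |u (i + 1) - u i| ≤ 2 * Real.pi * (1 + Real.pi) * M * (1 / ((i + 1 : ℕ) : ℝ)) := by
    intro i hi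
    rcases Nat.eq_zero_or_pos i with rfl | h1
    · rw [hu0, sub_zero]
      refine (hub _ hi).trans ?_
      have : 0 ≤ Real.pi * (M : ℝ) * Real.pi := by positivity
      simp
      linarith
    · have ha := hspos i h1 hi.le
      have hb := hspos (i + 1) (by omega) hi
      have hal := hsl i h1 hi.le
      have hbl := hsl (i + 1) (by omega) hi
      have hi0 : (0 : ℝ) < i := by exact_mod_cast h1
      have hi1 : (0 : ℝ) < ((i + 1 : ℕ) : ℝ) := by positivity
      have hstep : intNode n ((i + 1 : ℕ) : ℤ) - intNode n i = 2 * Real.pi / N := by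
        rw [hx, hx]; push_cast; ring
      have hvd : |v (i + 1) - v i| ≤ M * (2 * Real.pi / N) := by
        have := abs_sub_le_of_lipschitz hg (intNode n ((i + 1 : ℕ) : ℤ)) (intNode n i)
        rwa [hstep, abs_of_pos (a := 2 * Real.pi / N) (by positivity),
          ← sub_sub_sub_cancel_right _ _ (g 0)] at this
      have hsd : |s i - s (i + 1)| ≤ Real.pi / N := by
        have := Real.abs_sin_sub_sin_le ((intNode n i - δ) / 2) ((intNode n ((i + 1 : ℕ) : ℤ) - δ) / 2)
        refine this.trans (le_of_eq ?_)
        rw [abs_sub_comm, show (intNode n ((i + 1 : ℕ) : ℤ) - δ) / 2 - (intNode n i - δ) / 2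
          = (intNode n ((i + 1 : ℕ) : ℤ) - intNode n i) / 2 by ring, hstep,
          abs_of_pos (by positivity)]
        ring
      have e : u (i + 1) - u i
          = (v (i + 1) - v i) / s (i + 1) + v i / s i * (s i - s (i + 1)) / s (i + 1) := by
        simp only [hu]; field_simp; ring
      rw [e, ← add_div, abs_div, abs_of_pos hb, div_le_iff₀ hb]
      have h2 : |(v (i + 1) - v i) + v i / s i * (s i - s (i + 1))|
          ≤ M * (2 * Real.pi / N) + 2 * Real.pi * M * (Real.pi / N) := by
        refine (abs_add_le _ _).trans (add_le_add hvd ?_)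
        rw [abs_mul]
        exact mul_le_mul (hub i hi.le) hsd (abs_nonneg _) (by positivity)
      refine h2.trans ?_
      have h3 := mul_le_mul_of_nonneg_left hbl
        (by positivity : 0 ≤ 2 * Real.pi * (1 + Real.pi) * (M : ℝ) * (1 / ((i + 1 : ℕ) : ℝ)))
      refine le_trans (le_of_eq ?_) h3
      field_simp
  have hterm : ∀ i ∈ Finset.range n, (g (intNode n ((i + 1 : ℕ) : ℤ)) - g 0)
        * dirichletSum n (δ - intNode n ((i + 1 : ℕ) : ℤ))
      = -Real.sin (N * δ / 2) * ((-1) ^ (i + 1) * u (i + 1)) := by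
    intro i hi
    have hb := hspos (i + 1) (by omega) (Finset.mem_range.1 hi)
    have h := dirichletSum_sub_intNode_mul n (i + 1) δ
    have h' : dirichletSum n (δ - intNode n ((i + 1 : ℕ) : ℤ))
        = -((-1) ^ (i + 1) * Real.sin (N * δ / 2)) / s (i + 1) := by
      rw [eq_div_iff hb.ne']; exact h
    rw [h']
    simp only [hu, hv]; ring
  rw [Finset.sum_congr rfl hterm, ← Finset.mul_sum, abs_mul, abs_neg]
  have hsin : |Real.sin (N * δ / 2)| ≤ N * |δ| / 2 := by
    refine (Real.abs_sin_le_abs).trans (le_of_eq ?_)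
    rw [abs_div, abs_mul, abs_of_pos hN, abs_two]
  refine mul_le_mul hsin ?_ (abs_nonneg _) (by positivity)
  have halt := abs_alternating_sum_le u n
  have hsplit : ∑ i ∈ Finset.range n, (-1) ^ (i + 1) * u (i + 1)
      = (∑ i ∈ Finset.range n, (-1) ^ i * u i + (-1) ^ n * (u n / 2)) + (-1) ^ n * (u n / 2) := by
    have h1 := Finset.sum_range_succ (fun i => (-1) ^ i * u i) n
    have h2 := Finset.sum_range_succ' (fun i => (-1) ^ i * u i) n
    rw [hu0, mul_zero, add_zero] at h2
    rw [← h2, h1]; ring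
  rw [hsplit]
  refine (abs_add_le _ _).trans ?_
  have hlast : |(-1 : ℝ) ^ n * (u n / 2)| ≤ Real.pi * M := by
    rw [abs_mul, abs_pow, abs_neg, abs_one, one_pow, one_mul, abs_div, abs_two]
    have := hub n le_rfl
    linarith
  have hds : ∑ i ∈ Finset.range n, |u (i + 1) - u i|
      ≤ 2 * Real.pi * (1 + Real.pi) * M * (1 + Real.log n) := by
    refine (Finset.sum_le_sum fun i hi => hdiff i (Finset.mem_range.1 hi)).trans ?_
    rw [← Finset.mul_sum]
    exact mul_le_mul_of_nonneg_left (sum_one_div_succ_le n) (by positivity)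
  rw [hu0, abs_zero] at halt
  linarith

/-- At distance `δ` from its nearest node, the interpolant of exact data differs from the value at
that node by `O(M δ log n)`. -/
theorem abs_inferredResponse_sub_node_le {n : ℕ} {k₀ : ℤ} {t : ℝ}
    (ht : |t - intNode n k₀| ≤ Real.pi / (2 * (n : ℝ) + 1))
    {f : ℝ → ℝ} {M : ℝ≥0} (hper : Function.Periodic f (2 * Real.pi)) (hf : LipschitzWith M f) :
    |inferredResponse n (fun k => f (sampleNode n k)) t - f (intNode n k₀)|
      ≤ M * |t - intNode n k₀| * (Real.pi * (1 + Real.pi) * (1 + Real.log n) + Real.pi) := by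
  have hN : 0 < 2 * (n : ℝ) + 1 := by positivity
  set x₀ := intNode n k₀ with hx₀
  set δ := t - x₀ with hδ
  have e : inferredResponse n (fun k => f (sampleNode n k)) t - f x₀
      = (∑ k, (f (sampleNode n k) - f x₀) * dirichletSum n (t - sampleNode n k))
        / (2 * (n : ℝ) + 1) := by
    conv_lhs => rw [← inferredResponse_const n (f x₀) t, ← inferredResponse_sub]
    rw [inferredResponse_eq]
    rfl
  have hp : Function.Periodic (fun k : ℤ => (f (intNode n k) - f x₀)
      * dirichletSum n (t - intNode n k)) ((2 * n + 1 : ℕ) : ℤ) := by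
    intro k
    simp only [intNode_add n k, intNode_period]
    rw [hper]
    have h2 := dirichletSum_intNode_sub n k 1 t
    rw [mul_one, intNode_add, intNode_period] at h2
    rw [h2]
  rw [e]
  simp only [sampleNode_eq_intNode]
  rw [sum_fin_periodic n hp k₀, ← hx₀, sub_self, zero_mul, zero_add, abs_div, abs_of_pos hN,
    div_le_iff₀ hN]
  have hg₁ : LipschitzWith M (fun y => f (x₀ + y)) := by
    refine LipschitzWith.of_dist_le_mul fun y z => ?_
    simpa using hf.dist_le_mul (x₀ + y) (x₀ + z)
  have hg₂ : LipschitzWith M (fun y => f (x₀ - y)) := by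
    refine LipschitzWith.of_dist_le_mul fun y z => ?_
    simpa only [dist_sub_left] using hf.dist_le_mul (x₀ - y) (x₀ - z)
  have h1 := abs_oneSided_sum_le ht hg₁
  have h2 := abs_oneSided_sum_le (δ := -δ) (by rwa [abs_neg]) hg₂
  simp only [add_zero, sub_zero, abs_neg] at h1 h2
  have s1 : ∑ i ∈ Finset.range n, (f (intNode n (k₀ + ((i + 1 : ℕ) : ℤ))) - f x₀)
        * dirichletSum n (t - intNode n (k₀ + ((i + 1 : ℕ) : ℤ)))
      = ∑ i ∈ Finset.range n, (f (x₀ + intNode n ((i + 1 : ℕ) : ℤ)) - f x₀)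
        * dirichletSum n (δ - intNode n ((i + 1 : ℕ) : ℤ)) := by
    refine Finset.sum_congr rfl fun i _ => ?_
    rw [intNode_add, ← sub_sub]
  have s2 : ∑ i ∈ Finset.range n, (f (intNode n (k₀ - ((i + 1 : ℕ) : ℤ))) - f x₀)
        * dirichletSum n (t - intNode n (k₀ - ((i + 1 : ℕ) : ℤ)))
      = ∑ i ∈ Finset.range n, (f (x₀ - intNode n ((i + 1 : ℕ) : ℤ)) - f x₀)
        * dirichletSum n (-δ - intNode n ((i + 1 : ℕ) : ℤ)) := by
    refine Finset.sum_congr rfl fun i _ => ?_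
    rw [sub_eq_add_neg k₀, intNode_add, intNode_neg, ← sub_eq_add_neg, ← hx₀,
      ← dirichletSum_neg n (-δ - _)]
    congr 2
    ring
  rw [s1, s2]
  refine (abs_add_le _ _).trans ((add_le_add h1 h2).trans (le_of_eq ?_))
  ring

/-! ### Estimation error and conclusion -/

theorem abs_inferredResponse_le {n : ℕ} {k₀ : ℤ} {t : ℝ}
    (ht : |t - intNode n k₀| ≤ Real.pi / (2 * (n : ℝ) + 1))
    {d : Fin (2 * n + 1) → ℝ} {ε : ℝ} (hd : ∀ k, |d k| ≤ ε) :
    |inferredResponse n d t| ≤ ε * (3 + 2 * Real.log n) := by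
  have hN : 0 < 2 * (n : ℝ) + 1 := by positivity
  have hε : 0 ≤ ε := (abs_nonneg _).trans (hd 0)
  rw [inferredResponse_eq, abs_div, abs_of_pos hN, div_le_iff₀ hN]
  calc |∑ k, d k * dirichletSum n (t - sampleNode n k)|
      ≤ ∑ k, ε * |dirichletSum n (t - sampleNode n k)| := by
        refine (Finset.abs_sum_le_sum_abs _ _).trans (Finset.sum_le_sum fun k _ => ?_)
        rw [abs_mul]
        exact mul_le_mul_of_nonneg_right (hd k) (abs_nonneg _)
    _ ≤ ε * ((2 * (n : ℝ) + 1) * (3 + 2 * Real.log n)) := by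
        rw [← Finset.mul_sum]
        exact mul_le_mul_of_nonneg_left (sum_abs_dirichletSum_le n ht) hε
    _ = _ := by ring

theorem exists_nearest_intNode (n : ℕ) (t : ℝ) :
    ∃ k₀ : ℤ, |t - intNode n k₀| ≤ Real.pi / (2 * (n : ℝ) + 1) ∧
      ∀ k : ℤ, |t - intNode n k₀| ≤ |t - intNode n k| := by
  have hN : 0 < 2 * (n : ℝ) + 1 := by positivity
  have hpi := Real.pi_pos
  set h : ℝ := 2 * Real.pi / (2 * (n : ℝ) + 1) with hh
  have hpos : 0 < h := by positivity
  have e : ∀ k : ℤ, |t - intNode n k| = h * |t / h - k| := by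
    intro k
    rw [← abs_of_pos hpos, ← abs_mul, abs_of_pos hpos, mul_sub, mul_div_cancel₀ _ hpos.ne']
    congr 2
    simp only [intNode, hh]; ring
  refine ⟨round (t / h), ?_, fun k => ?_⟩
  · rw [e]
    calc _ ≤ h * (1 / 2) := mul_le_mul_of_nonneg_left (abs_sub_round _) hpos.le
      _ = _ := by rw [hh]; ring
  · rw [e, e]
    exact mul_le_mul_of_nonneg_left (round_le _ _) hpos.le

theorem theorem3 (p C : ℝ) (hp : 0 < p) :
    ∃ K : ℝ, ∀ (n : ℕ), 2 ≤ n →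
      ∀ (f : ℝ → ℝ) (M : ℝ≥0),
        Function.Periodic f (2 * Real.pi) → (∀ t, |f t| ≤ 1) → LipschitzWith M f →
        ∀ (d : Fin (2 * n + 1) → ℝ) (θ : ℝ),
          (∃ k : Fin (2 * n + 1), |θ - sampleNode n k| ≤ C / (n : ℝ) ^ p) →
          |f θ - inferredResponse n d θ| ≤
            K * max ((M : ℝ) * Real.log n / (n : ℝ) ^ (max 1 p))
              (maxEstimationError n f d * Real.log n) := by
  -- `max C π` bounds the distance to the nearest node times `n ^ max 1 p`; `70` and `8` absorb
  -- the additive constants next to `log n ≥ log 2 > 1/2`.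
  refine ⟨70 * max C Real.pi + 8, ?_⟩
  intro n hn f M hper _ hf d θ ⟨k, hk⟩
  have hpi := Real.pi_pos
  have hn2 : (2 : ℝ) ≤ n := by exact_mod_cast hn
  have hn0 : (0 : ℝ) < n := by linarith
  have hlog : 1 ≤ 2 * Real.log n := by
    have := Real.log_le_log (by norm_num) hn2
    have := Real.log_two_gt_d9
    linarith
  obtain ⟨k₀, hk₀, hmin⟩ := exists_nearest_intNode n θ
  -- The nearest node is within half the spacing `2π/(2n+1)` and no farther than the given node,
  -- so its distance satisfies the bounds for both exponents `1` and `p`.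
  set δ := |θ - intNode n k₀| with hδ
  set ε := maxEstimationError n f d with hε
  have hd : ∀ k, |f (sampleNode n k) - d k| ≤ ε := fun k =>
    Finset.le_sup' (fun k => |f (sampleNode n k) - d k|) (Finset.mem_univ k)
  have hε0 : 0 ≤ ε := (abs_nonneg _).trans (hd 0)
  have hδ0 : 0 ≤ δ := abs_nonneg _
  have hC := le_max_left C Real.pi
  have hC' := le_max_right C Real.pi
  set C' := max C Real.pi with hCdef
  have hδle : δ ≤ C' / (n : ℝ) ^ (max 1 p) := by
    rcases le_total p 1 with h | h
    · rw [max_eq_left h, Real.rpow_one]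
      refine hk₀.trans ?_
      gcongr
      linarith
    · rw [max_eq_right h]
      have h1 : δ ≤ C / (n : ℝ) ^ p := by
        refine (hmin ((k : ℕ) : ℤ)).trans ?_
        rwa [← sampleNode_eq_intNode]
      refine h1.trans ?_
      gcongr
  have h1 : |f θ - f (intNode n k₀)| ≤ M * δ := abs_sub_le_of_lipschitz hf _ _
  have h2 := abs_inferredResponse_sub_node_le hk₀ hper hf
  have h3 := abs_inferredResponse_le hk₀ (d := (fun k => f (sampleNode n k)) - d) hd
  rw [inferredResponse_sub] at h3
  rw [← hδ] at h2
  have hsum : |f θ - inferredResponse n d θ| ≤ M * δ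
      + M * δ * (Real.pi * (1 + Real.pi) * (1 + Real.log n) + Real.pi)
      + ε * (3 + 2 * Real.log n) := by
    have e : f θ - inferredResponse n d θ = (f θ - f (intNode n k₀))
        - (inferredResponse n (fun k => f (sampleNode n k)) θ - f (intNode n k₀))
        + (inferredResponse n (fun k => f (sampleNode n k)) θ - inferredResponse n d θ) := by ring
    rw [e]
    refine (abs_add_le _ _).trans (add_le_add ((abs_sub _ _).trans (add_le_add h1 h2)) h3)
  have hMδ : 0 ≤ M * δ := by positivity
  have hpi4 : Real.pi ≤ 3.15 := Real.pi_lt_d2.le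
  have hfac : 1 + (Real.pi * (1 + Real.pi) * (1 + Real.log n) + Real.pi) ≤ 70 * Real.log n := by
    have : Real.pi * (1 + Real.pi) ≤ 14 := by nlinarith
    have := mul_le_mul_of_nonneg_right this (by linarith : 0 ≤ 1 + Real.log n)
    linarith
  have hA : M * δ * (1 + (Real.pi * (1 + Real.pi) * (1 + Real.log n) + Real.pi))
      ≤ 70 * C' * (M * Real.log n / (n : ℝ) ^ (max 1 p)) := by
    calc _ ≤ M * (C' / (n : ℝ) ^ (max 1 p)) * (70 * Real.log n) :=
          mul_le_mul (by gcongr) hfac (by have := Real.log_nonneg (by linarith : (1 : ℝ) ≤ n); positivity)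
            (by have : 0 ≤ C' := by linarith
                positivity)
      _ = _ := by ring
  have hB : ε * (3 + 2 * Real.log n) ≤ 8 * (ε * Real.log n) := by
    have := mul_le_mul_of_nonneg_left (by linarith : 3 + 2 * Real.log n ≤ 8 * Real.log n) hε0
    linarith
  have hA' := mul_le_mul_of_nonneg_left
    (le_max_left (M * Real.log n / (n : ℝ) ^ (max 1 p)) (ε * Real.log n))
    (by linarith : 0 ≤ 70 * C')
  have hB' := mul_le_mul_of_nonneg_left
    (le_max_right (M * Real.log n / (n : ℝ) ^ (max 1 p)) (ε * Real.log n))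
    (by norm_num : (0 : ℝ) ≤ 8)
  linarith
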